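/- Theorem 3.4. Let $\mathbb{N}=\{1,2,3,\dots\}$ and let $g:\mathbb{N}\to[1,\infty)$ be a function. Suppose that $(\lambda g(n))_{n=1}^\infty$ is uniformly distributed mod 1 for every irrational real number $\lambda$, and that $(g(n)/m)_{n=1}^\infty$ is uniformly distributed mod 1 for every integer $m\ge 2$. Then the sequence $([g(n)])_{n=1}^\infty$, where $[\cdot]$ denotes the integral part, is norm ergodic; that is, for every probability space $(X,\mathcal{B},\mu)$, every ergodic invertible measure-preserving transformation $T:X\to X$ and every complex-valued $f\in L^2(\mu)$, $$\lim_{N\to\infty}\left\|\frac1N\sum_{n=1}^N f\circ T^{[g(n)]}-\int_X f\,d\mu\right\|_{L^2(\mu)}=0 .$$ -/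

import Mathlib

open Filter Topology MeasureTheory

universe u

/-- A real sequence `(x n)_{n ≥ 1}` is uniformly distributed mod 1: for every `0 ≤ a < b ≤ 1`, the
proportion of `1 ≤ n ≤ N` whose fractional part `{x n}` lies in `[a, b)` tends to `b - a`.
The value `x 0` is not used. -/
def IsUniformlyDistributedModOne (x : ℕ → ℝ) : Prop :=
  ∀ a b : ℝ, 0 ≤ a → a < b → b ≤ 1 →
    Tendsto
      (fun N : ℕ => (({n ∈ Finset.Icc 1 N | Int.fract (x n) ∈ Set.Ico a b}.card : ℕ) : ℝ) / (N : ℝ))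
      atTop (𝓝 (b - a))

/-- A sequence `(a n)_{n ≥ 1}` of natural numbers is norm ergodic: for every ergodic invertible
measure-preserving system `(X, μ, T)` (`μ` a probability measure, `T` a bijective ergodic map) and
every `f ∈ L²`, the averages of `f ∘ T^(a n)`, `1 ≤ n ≤ N`, converge to `∫ f` in the `L²`-norm.
The value `a 0` is not used. -/
def IsNormErgodic (a : ℕ → ℕ) : Prop :=
  ∀ (X : Type u) [MeasurableSpace X] (μ : Measure X) [IsProbabilityMeasure μ] (T : X → X),
    Function.Bijective T → Ergodic T μ → ∀ f : X → ℂ, MemLp f 2 μ →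
      Tendsto
        (fun N : ℕ =>
          eLpNorm (fun x => (1 / (N : ℂ)) * ∑ n ∈ Finset.Icc 1 N, f (T^[a n] x) - ∫ y, f y ∂μ) 2 μ)
        atTop (𝓝 0)

/-! The proof reduces norm ergodicity to scalar exponential sums by the spectral theorem. After
subtracting `∫ f`, the function lies in the kernel of the mean ergodic projection, because the fixed
vectors of an ergodic Koopman operator are constants. Its spectral measure `σ` on the circle
therefore has no atom at `0` (`spectralMeasure_singleton_zero`). The squared norm of the average
along `[g n]` is the `σ`-integral of the squared modulus of the average of `e([g n] θ)`, which is at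
most 1, so dominated convergence finishes once these averages tend to 0 for every `θ ≠ 0`
(`tendsto_mean_iterate_zero`).

That convergence (`tendsto_cesaroMean_fourier_floor`) is where `g` enters. For `θ = p/q` in lowest
terms, uniform distribution of `g/q` equidistributes `[g n]` among the residues mod `q`. For
irrational `t`, `e([g] t) = e(t g) e(-t {g})`; the second factor is almost a continuous function of
`g` mod 1, and its Fourier modes give `e((t + k) g)` with `t + k` irrational. -/

/-! ### Cesàro means and uniform distribution -/

/-- The average of `u 1, …, u N`. -/
noncomputable def cesaroMean (u : ℕ → ℂ) (N : ℕ) : ℂ := (1 / (N : ℂ)) * ∑ n ∈ Finset.Icc 1 N, u n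

theorem cesaroMean_add (u v : ℕ → ℂ) (N : ℕ) :
    cesaroMean (fun n => u n + v n) N = cesaroMean u N + cesaroMean v N := by
  simp [cesaroMean, Finset.sum_add_distrib, mul_add]

theorem cesaroMean_const_mul (c : ℂ) (u : ℕ → ℂ) (N : ℕ) :
    cesaroMean (fun n => c * u n) N = c * cesaroMean u N := by
  simp only [cesaroMean, ← Finset.mul_sum]; ring

theorem cesaroMean_sum {ι : Type*} (s : Finset ι) (u : ι → ℕ → ℂ) (N : ℕ) :
    cesaroMean (fun n => ∑ i ∈ s, u i n) N = ∑ i ∈ s, cesaroMean (u i) N := by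
  simp only [cesaroMean, Finset.mul_sum]
  rw [Finset.sum_comm]

theorem norm_cesaroMean_sub_le (u v : ℕ → ℂ) (N : ℕ) :
    ‖cesaroMean u N - cesaroMean v N‖ ≤ (∑ n ∈ Finset.Icc 1 N, ‖u n - v n‖) / N := by
  have : cesaroMean u N - cesaroMean v N = (1 / (N : ℂ)) * ∑ n ∈ Finset.Icc 1 N, (u n - v n) := by
    simp only [cesaroMean, Finset.sum_sub_distrib, mul_sub]
  rw [this, norm_mul, norm_div, norm_one, Complex.norm_natCast, div_mul_eq_mul_div, one_mul]
  gcongr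
  exact norm_sum_le _ _

/-- Means tend to zero if the sequence can be approximated in mean by sequences whose means
tend to zero. -/
theorem tendsto_cesaroMean_zero_of_approx {u : ℕ → ℂ}
    (h : ∀ ε : ℝ, 0 < ε → ∃ v : ℕ → ℂ, Tendsto (cesaroMean v) atTop (𝓝 0) ∧
      ∀ᶠ N : ℕ in atTop, (∑ n ∈ Finset.Icc 1 N, ‖u n - v n‖) / (N : ℝ) ≤ ε) :
    Tendsto (cesaroMean u) atTop (𝓝 0) := by
  rw [Metric.tendsto_nhds]
  intro ε hε
  obtain ⟨v, hv, hN⟩ := h (ε / 2) (half_pos hε)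
  filter_upwards [hN, (Metric.tendsto_nhds.1 hv) (ε / 2) (half_pos hε)] with N h1 h2
  rw [dist_zero_right] at h2 ⊢
  have h3 := norm_cesaroMean_sub_le u v N
  have h4 := norm_le_norm_add_norm_sub' (cesaroMean u N) (cesaroMean v N)
  linarith

theorem sum_div_le_of_forall_le {w : ℕ → ℝ} {ε : ℝ} (hε : 0 ≤ ε) (h : ∀ n, 1 ≤ n → w n ≤ ε)
    (N : ℕ) : (∑ n ∈ Finset.Icc 1 N, w n) / (N : ℝ) ≤ ε := by
  apply div_le_of_le_mul₀ (Nat.cast_nonneg _) hε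
  calc _ ≤ ∑ n ∈ Finset.Icc 1 N, ε := Finset.sum_le_sum fun n hn => h n (Finset.mem_Icc.1 hn).1
    _ = _ := by simp [mul_comm]

/-- The means of a function of the position of `x n` in the partition of the circle into `q` equal
arcs. -/
theorem IsUniformlyDistributedModOne.tendsto_cesaroMean_step {x : ℕ → ℝ}
    (hx : IsUniformlyDistributedModOne x) {q : ℕ} (hq : 0 < q) (c : ℕ → ℂ) :
    Tendsto (cesaroMean fun n => c ⌊q * Int.fract (x n)⌋₊) atTop
      (𝓝 ((1 / (q : ℂ)) * ∑ j ∈ Finset.range q, c j)) := by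
  have hq' : (0 : ℝ) < q := by exact_mod_cast hq
  have key : ∀ j : ℕ, ∀ y : ℝ, 0 ≤ y →
      (⌊q * y⌋₊ = j ↔ y ∈ Set.Ico ((j : ℝ) / q) ((j + 1 : ℝ) / q)) := by
    intro j y hy
    rw [Nat.floor_eq_iff (by positivity), Set.mem_Ico, div_le_iff₀ hq', lt_div_iff₀ hq', mul_comm]
  have h1 : ∀ j ∈ Finset.range q, Tendsto
      (cesaroMean fun n => if ⌊q * Int.fract (x n)⌋₊ = j then 1 else 0) atTop
      (𝓝 (1 / (q : ℂ))) := by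
    intro j hj
    have hj' : (j : ℝ) + 1 ≤ q := by exact_mod_cast Finset.mem_range.1 hj
    have := hx (j / q) ((j + 1) / q) (by positivity)
      (by gcongr; linarith) (by rw [div_le_one hq']; exact hj')
    have h2 := (Complex.continuous_ofReal.tendsto _).comp this
    have h3 : (((((j : ℝ) + 1) / q - j / q : ℝ)) : ℂ) = 1 / (q : ℂ) := by
      push_cast; ring
    rw [h3] at h2
    refine h2.congr fun N => ?_
    simp only [Function.comp, cesaroMean, key j _ (Int.fract_nonneg _), Finset.sum_boole]
    push_cast
    ring
  have h2 := tendsto_finsetSum _ fun j hj => (h1 j hj).const_mul (c j)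
  have h3 : ∑ j ∈ Finset.range q, c j * (1 / (q : ℂ)) =
      (1 / (q : ℂ)) * ∑ j ∈ Finset.range q, c j := by
    rw [Finset.mul_sum]; exact Finset.sum_congr rfl fun _ _ => mul_comm _ _
  rw [h3] at h2
  refine h2.congr fun N => ?_
  simp_rw [← cesaroMean_const_mul]
  rw [← cesaroMean_sum]
  congr 1
  ext n
  have hlt : ⌊q * Int.fract (x n)⌋₊ < q := by
    rw [Nat.floor_lt (mul_nonneg hq'.le (Int.fract_nonneg _))]
    nlinarith [Int.fract_lt_one (x n)]
  simp [hlt]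

/-! ### Characters and Weyl's criterion -/

/-- The function `s ↦ e^{2πis}`. -/
noncomputable def unitExp (s : ℝ) : ℂ := Complex.exp (2 * Real.pi * Complex.I * s)

theorem unitExp_add (s t : ℝ) : unitExp (s + t) = unitExp s * unitExp t := by
  rw [unitExp, unitExp, unitExp, ← Complex.exp_add]; push_cast; ring_nf

theorem norm_unitExp (s : ℝ) : ‖unitExp s‖ = 1 := by
  rw [unitExp, show (2 * Real.pi * Complex.I * s : ℂ) = ((2 * Real.pi * s : ℝ) : ℂ) * Complex.I by
    push_cast; ring, Complex.norm_exp_ofReal_mul_I]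

theorem continuous_unitExp : Continuous unitExp := by unfold unitExp; fun_prop

theorem unitExp_eq_one_iff (s : ℝ) : unitExp s = 1 ↔ ∃ n : ℤ, s = n := by
  rw [unitExp, Complex.exp_eq_one_iff]
  refine exists_congr fun n => ?_
  have hpi : (2 * Real.pi * Complex.I : ℂ) ≠ 0 := Complex.two_pi_I_ne_zero
  rw [mul_comm (n : ℂ), mul_right_inj' hpi]
  exact_mod_cast Iff.rfl

theorem unitExp_intCast (n : ℤ) : unitExp n = 1 := (unitExp_eq_one_iff _).2 ⟨n, rfl⟩

theorem unitExp_natCast_mul (n : ℕ) (s : ℝ) : unitExp (n * s) = unitExp s ^ n := by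
  rw [unitExp, unitExp, ← Complex.exp_nat_mul]; push_cast; ring_nf

theorem norm_unitExp_sub_le (s t : ℝ) : ‖unitExp s - unitExp t‖ ≤ 2 * Real.pi * |s - t| := by
  have h : unitExp s - unitExp t = unitExp t * (unitExp (s - t) - 1) := by
    rw [mul_sub, ← unitExp_add, mul_one]; ring_nf
  rw [h, norm_mul, norm_unitExp, one_mul, unitExp,
    show (2 * Real.pi * Complex.I * (s - t : ℝ) : ℂ) =
      Complex.I * ((2 * Real.pi * (s - t) : ℝ) : ℂ) by push_cast; ring]
  refine (Real.norm_exp_I_mul_ofReal_sub_one_le).trans ?_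
  rw [Real.norm_eq_abs, abs_mul, abs_of_pos Real.two_pi_pos]

theorem fourier_coe_eq_unitExp (k : ℤ) (s : ℝ) :
    fourier k (s : UnitAddCircle) = unitExp (k * s) := by
  rw [fourier_coe_apply, unitExp]; push_cast; ring_nf

/-- A nontrivial `q`-th root of unity has vanishing power sum. -/
theorem sum_unitExp_eq_zero {q : ℕ} {s : ℝ} (h : ∃ n : ℤ, q * s = n) (hs : ¬ ∃ n : ℤ, s = n) :
    ∑ j ∈ Finset.range q, unitExp (j * s) = 0 := by
  have hs' : unitExp s ≠ 1 := fun h => hs ((unitExp_eq_one_iff s).1 h)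
  simp_rw [unitExp_natCast_mul]
  rw [geom_sum_eq hs', ← unitExp_natCast_mul, (unitExp_eq_one_iff _).2 h, sub_self, zero_div]

/-- **Weyl's criterion**, necessity. -/
theorem IsUniformlyDistributedModOne.tendsto_cesaroMean_unitExp {x : ℕ → ℝ}
    (hx : IsUniformlyDistributedModOne x) {k : ℤ} (hk : k ≠ 0) :
    Tendsto (cesaroMean fun n => unitExp (k * x n)) atTop (𝓝 0) := by
  refine tendsto_cesaroMean_zero_of_approx fun ε hε => ?_
  -- The bound `q > |k|` keeps `k / q` from being an integer, so the step function has mean zero; `q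
  -- > 2π|k|/ε` makes it uniformly `ε`-close to the character.
  obtain ⟨q, hq⟩ := exists_nat_gt (max (|(k : ℝ)|) (2 * Real.pi * |(k : ℝ)| / ε))
  obtain ⟨hq1, hq2⟩ := max_lt_iff.1 hq
  have hk' : 0 < |(k : ℝ)| := by positivity
  have hq0 : (0 : ℝ) < q := hk'.trans hq1
  refine ⟨fun n => unitExp ((⌊q * Int.fract (x n)⌋₊ : ℕ) * (k / q : ℝ)), ?_, Eventually.of_forall
    (sum_div_le_of_forall_le hε.le fun n _ => ?_)⟩
  · have := hx.tendsto_cesaroMean_step (by exact_mod_cast hq0 : 0 < q)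
      (fun j => unitExp (j * (k / q : ℝ)))
    rwa [sum_unitExp_eq_zero ⟨k, by field_simp⟩, mul_zero] at this
    rintro ⟨n, hn⟩
    rw [div_eq_iff hq0.ne'] at hn
    have hn' : n ≠ 0 := by rintro rfl; simp at hn; exact hk hn
    rw [hn, abs_mul, abs_of_pos hq0] at hq1
    have : (1 : ℝ) ≤ |(n : ℝ)| := by exact_mod_cast Int.one_le_abs hn'
    nlinarith
  · have h1 : unitExp (k * x n) = unitExp (k * Int.fract (x n)) := by
      have : (k : ℝ) * x n = ((k * ⌊x n⌋ : ℤ) : ℝ) + k * Int.fract (x n) := by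
        rw [Int.fract]; push_cast; ring
      rw [this, unitExp_add, unitExp_intCast, one_mul]
    rw [h1]
    refine (norm_unitExp_sub_le _ _).trans ?_
    set y := Int.fract (x n)
    have hy : 0 ≤ q * y := mul_nonneg hq0.le (Int.fract_nonneg _)
    have h2 : k * y - (⌊q * y⌋₊ : ℕ) * (k / q : ℝ) = k / q * (q * y - ⌊q * y⌋₊) := by
      field_simp
    have h3 : |q * y - ⌊q * y⌋₊| ≤ 1 := by
      rw [abs_le]
      constructor <;> linarith [Nat.floor_le hy, Nat.lt_floor_add_one (q * y)]
    rw [h2, abs_mul, abs_div, abs_of_pos hq0]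
    rw [div_lt_iff₀ hε] at hq2
    calc 2 * Real.pi * (|(k : ℝ)| / q * |q * y - ⌊q * y⌋₊|)
        ≤ 2 * Real.pi * (|(k : ℝ)| / q * 1) := by gcongr
      _ = 2 * Real.pi * |(k : ℝ)| / q := by ring
      _ ≤ ε := by rw [div_le_iff₀ hq0]; linarith

/-- Trigonometric polynomials are uniformly dense in the continuous functions on the circle, and
since `|u n| ≤ 1` a uniform error passes to the means unamplified. -/
theorem tendsto_cesaroMean_mul_continuousMap {u : ℕ → ℂ} (hu : ∀ n, ‖u n‖ ≤ 1) {x : ℕ → ℝ}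
    (h : ∀ k : ℤ, Tendsto (cesaroMean fun n => u n * unitExp (k * x n)) atTop (𝓝 0))
    (φ : C(UnitAddCircle, ℂ)) :
    Tendsto (cesaroMean fun n => u n * φ (x n : UnitAddCircle)) atTop (𝓝 0) := by
  have hspan : ∀ ψ ∈ Submodule.span ℂ (Set.range (@fourier (1 : ℝ))),
      Tendsto (cesaroMean fun n => u n * ψ (x n : UnitAddCircle)) atTop (𝓝 0) := by
    intro ψ hψ
    induction hψ using Submodule.span_induction with
    | mem ψ hψ =>
      obtain ⟨k, rfl⟩ := hψ
      simpa only [fourier_coe_eq_unitExp] using h k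
    | zero =>
      refine tendsto_const_nhds.congr fun N => ?_
      simp [cesaroMean]
    | add ψ χ _ _ h1 h2 =>
      have := h1.add h2
      simp_rw [← cesaroMean_add, add_zero] at this
      simpa only [ContinuousMap.add_apply, mul_add] using this
    | smul c ψ _ h1 =>
      have := h1.const_mul c
      simp_rw [← cesaroMean_const_mul, mul_zero] at this
      refine this.congr fun N => ?_
      congr 1
      ext n
      simp; ring
  refine tendsto_cesaroMean_zero_of_approx fun ε hε => ?_
  have hφ : φ ∈ closure (Submodule.span ℂ (Set.range (@fourier (1 : ℝ))) :
      Set C(UnitAddCircle, ℂ)) := by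
    rw [← Submodule.topologicalClosure_coe, span_fourier_closure_eq_top]; trivial
  obtain ⟨ψ, hψ, hd⟩ := Metric.mem_closure_iff.1 hφ ε hε
  refine ⟨_, hspan ψ hψ, Eventually.of_forall
    (sum_div_le_of_forall_le hε.le fun n _ => ?_)⟩
  rw [← mul_sub, norm_mul]
  calc _ ≤ 1 * dist φ ψ := by
        gcongr
        · exact hu n
        · rw [← dist_eq_norm]; exact ContinuousMap.dist_apply_le_dist _
    _ ≤ ε := by linarith

/-! ### Exponential sums along the integral part -/

/-- If `g n / 2` is uniformly distributed, then `g n` is asymptotically in the arc `[1 - δ, 1)` with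
frequency at most `2 δ`. -/
theorem eventually_card_fract_ge_le {g : ℕ → ℝ}
    (h2 : IsUniformlyDistributedModOne fun n => g n / 2) {δ : ℝ} (h0 : 0 < δ) (h1 : δ < 1) :
    ∀ᶠ N : ℕ in atTop,
      (({n ∈ Finset.Icc 1 N | 1 - δ ≤ Int.fract (g n)}.card : ℕ) : ℝ) / (N : ℝ) ≤ 2 * δ := by
  -- By the parity of `⌊g n⌋`, `{g n / 2}` is `{g n} / 2` or `(1 + {g n}) / 2`. The arc thus pulls
  -- back to two arcs of length `δ / 2`; the limiting frequency `δ` leaves room below `2 δ`.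
  have ha := h2 ((1 - δ) / 2) (1 / 2) (by linarith) (by linarith) (by norm_num)
  have hb := h2 (1 - δ / 2) 1 (by linarith) (by linarith) le_rfl
  have hab := ha.add hb
  filter_upwards [hab.eventually (ge_mem_nhds (show _ < 2 * δ by linarith))] with N hN
  refine le_trans ?_ hN
  beta_reduce
  rw [← add_div, ← Nat.cast_add]
  gcongr
  refine le_trans (Finset.card_le_card ?_) (Finset.card_union_le _ _)
  intro n hn
  simp only [Finset.mem_filter, Finset.mem_union, Set.mem_Ico] at hn ⊢
  obtain ⟨hn, hy⟩ := hn
  have hy1 := Int.fract_lt_one (g n)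
  have hy0 := Int.fract_nonneg (g n)
  have hg := Int.floor_add_fract (g n)
  rcases Int.even_or_odd' ⌊g n⌋ with ⟨m, hm | hm⟩
  · left
    have : Int.fract (g n / 2) = Int.fract (g n) / 2 := by
      rw [Int.fract_eq_iff]
      refine ⟨by linarith, by linarith, m, ?_⟩
      rw [hm] at hg; push_cast at hg; linarith
    rw [this]
    exact ⟨hn, by linarith, by linarith⟩
  · right
    have : Int.fract (g n / 2) = (1 + Int.fract (g n)) / 2 := by
      rw [Int.fract_eq_iff]
      refine ⟨by linarith, by linarith, m, ?_⟩
      rw [hm] at hg; push_cast at hg; linarith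
    rw [this]
    exact ⟨hn, by linarith, by linarith⟩

/-- The function `e(-t y)` on `[0, 1)` jumps at the endpoint, so it is corrected on `[1 - δ, 1)` to
become continuous on the circle. The hypothesis on `g / 2` bounds how often `g n` meets that arc. -/
theorem tendsto_cesaroMean_floor_of_irrational {g : ℕ → ℝ} (hg : ∀ n : ℕ, 1 ≤ n → 1 ≤ g n)
    (hirr : ∀ lam : ℝ, Irrational lam → IsUniformlyDistributedModOne (fun n => lam * g n))
    (h2 : IsUniformlyDistributedModOne fun n => g n / 2) {t : ℝ} (ht : Irrational t) :
    Tendsto (cesaroMean fun n => unitExp (⌊g n⌋₊ * t)) atTop (𝓝 0) := by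
  refine tendsto_cesaroMean_zero_of_approx fun ε hε => ?_
  set δ : ℝ := min (1 / 2) (ε / 4) with hδ
  have hδ0 : 0 < δ := by positivity
  have hδ1 : δ < 1 := (min_le_left _ _).trans_lt (by norm_num)
  have hδε : 4 * δ ≤ ε := by linarith [min_le_right (1 / 2) (ε / 4)]
  -- `w` is a ramp from 0 at `1 - δ` to 1 at `1`, and its coefficient in `F` is chosen so that `F 1
  -- = F 0 = 1`. The correction has size at most 2 on a set of frequency at most `2 δ`, whence `4 δ
  -- ≤ ε`.
  let w : ℝ → ℝ := fun y => max 0 (y - (1 - δ)) / δ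
  let F : ℝ → ℂ := fun y => unitExp (-t * y) + (1 - unitExp (-t)) * w y
  have hw1 : w 1 = 1 := by
    have : max 0 (1 - (1 - δ)) = δ := by rw [max_eq_right] <;> linarith
    simp only [w, this, div_self hδ0.ne']
  have hw0 : ∀ y, y ≤ 1 - δ → w y = 0 := fun y hy => by
    simp only [w]; rw [max_eq_left (by linarith), zero_div]
  have hwb : ∀ y, y ≤ 1 → |w y| ≤ 1 := fun y hy => by
    simp only [w]
    rw [abs_of_nonneg (by positivity), div_le_one hδ0]
    exact max_le hδ0.le (by linarith)
  have hFc : Continuous F := by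
    have : Continuous w := by fun_prop
    have := continuous_unitExp
    fun_prop
  have hF01 : F 0 = F (0 + 1) := by
    have : unitExp 0 = 1 := by simpa using unitExp_intCast 0
    simp only [F, zero_add, hw1, hw0 0 (by linarith), mul_zero, mul_one, this]
    push_cast; ring
  let φ : C(UnitAddCircle, ℂ) := ⟨_, AddCircle.liftIco_continuous hF01 hFc.continuousOn⟩
  have hφ : ∀ s : ℝ, φ (s : UnitAddCircle) = F (Int.fract s) := by
    intro s
    have h1 : (s : UnitAddCircle) = (Int.fract s : ℝ) := by
      conv_lhs => rw [← Int.floor_add_fract s]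
      rw [AddCircle.coe_add]
      have : ((⌊s⌋ : ℝ) : UnitAddCircle) = 0 := by
        rw [AddCircle.coe_eq_zero_iff]; exact ⟨⌊s⌋, by simp⟩
      rw [this, zero_add]
    rw [h1]
    change AddCircle.liftIco 1 0 F _ = _
    exact AddCircle.liftIco_coe_apply ⟨Int.fract_nonneg s, by rw [zero_add]; exact Int.fract_lt_one s⟩
  refine ⟨fun n => unitExp (t * g n) * φ (g n : UnitAddCircle),
    tendsto_cesaroMean_mul_continuousMap (fun n => (norm_unitExp _).le) (fun k => ?_) φ, ?_⟩
  · have := (hirr (t + k) (ht.add_intCast k)).tendsto_cesaroMean_unitExp one_ne_zero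
    refine this.congr fun N => ?_
    congr 1
    ext n
    rw [← unitExp_add]
    congr 1; push_cast; ring
  · filter_upwards [eventually_card_fract_ge_le h2 hδ0 hδ1] with N hN
    have hterm : ∀ n ∈ Finset.Icc 1 N,
        ‖unitExp (⌊g n⌋₊ * t) - unitExp (t * g n) * φ (g n : UnitAddCircle)‖ ≤
          if 1 - δ ≤ Int.fract (g n) then 2 else 0 := by
      intro n hn
      have hgn : (0 : ℝ) ≤ g n := zero_le_one.trans (hg n (Finset.mem_Icc.1 hn).1)
      have h1 : unitExp (⌊g n⌋₊ * t) = unitExp (t * g n) * unitExp (-t * Int.fract (g n)) := by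
        rw [← unitExp_add]
        congr 1
        rw [Int.fract, ← natCast_floor_eq_intCast_floor hgn]
        ring
      rw [h1, hφ, ← mul_sub, norm_mul, norm_unitExp, one_mul]
      simp only [F, sub_add_cancel_left, norm_neg, norm_mul, Complex.norm_real, Real.norm_eq_abs]
      split_ifs with hc
      · have h3 : ‖1 - unitExp (-t)‖ ≤ 2 := by
          refine (norm_sub_le _ _).trans ?_
          rw [norm_unitExp, norm_one]; norm_num
        have h4 := hwb _ (Int.fract_lt_one (g n)).le
        calc _ ≤ (2 : ℝ) * 1 := by gcongr
          _ = 2 := mul_one 2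
      · rw [hw0 _ (not_le.1 hc).le]; simp
    calc _ ≤ (∑ n ∈ Finset.Icc 1 N, if 1 - δ ≤ Int.fract (g n) then (2 : ℝ) else 0) / N := by
          gcongr with n hn; exact hterm n hn
      _ = 2 * ((({n ∈ Finset.Icc 1 N | 1 - δ ≤ Int.fract (g n)}.card : ℕ) : ℝ) / (N : ℝ)) := by
          rw [← Finset.sum_filter, Finset.sum_const, nsmul_eq_mul]; ring
      _ ≤ ε := by linarith

/-- With `q` the denominator of `r`, the residue of `⌊g n⌋` mod `q` is `⌊q {g n / q}⌋`, and the
exponential depends only on this residue. The residues equidistribute and the `q`-th roots of unity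
sum to zero. -/
theorem tendsto_cesaroMean_floor_of_rat {g : ℕ → ℝ} (hg : ∀ n : ℕ, 1 ≤ n → 1 ≤ g n)
    (hrat : ∀ m : ℕ, 2 ≤ m → IsUniformlyDistributedModOne (fun n => g n / (m : ℝ)))
    {r : ℚ} (hr : ¬ ∃ n : ℤ, (r : ℝ) = n) :
    Tendsto (cesaroMean fun n => unitExp (⌊g n⌋₊ * r)) atTop (𝓝 0) := by
  have hden : 2 ≤ r.den := by
    by_contra! hlt
    have h1 : r.den = 1 := by have := r.den_pos; omega
    exact hr ⟨r.num, by exact_mod_cast (Rat.den_eq_one_iff r).1 h1 |>.symm⟩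
  have hq : 0 < r.den := r.den_pos
  have hq' : (0 : ℝ) < r.den := by exact_mod_cast hq
  have hqr : (r.den : ℝ) * r = r.num := by exact_mod_cast Rat.den_mul_eq_num r
  have := (hrat r.den hden).tendsto_cesaroMean_step hq (fun j => unitExp (j * (r : ℝ)))
  rw [sum_unitExp_eq_zero ⟨r.num, hqr⟩ hr, mul_zero] at this
  refine this.congr fun N => ?_
  unfold cesaroMean
  congr 1
  refine Finset.sum_congr rfl fun n hn => ?_
  have hgn : (0 : ℝ) ≤ g n := zero_le_one.trans (hg n (Finset.mem_Icc.1 hn).1)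
  set m : ℤ := ⌊g n / r.den⌋ with hm
  have h1 : (r.den : ℝ) * Int.fract (g n / r.den) = g n - (r.den * m : ℤ) := by
    rw [Int.fract, mul_sub, mul_div_cancel₀ _ hq'.ne', ← hm]; push_cast; ring
  have h2 : ((⌊(r.den : ℝ) * Int.fract (g n / r.den)⌋₊ : ℕ) : ℝ) =
      (⌊g n⌋₊ : ℕ) - (r.den * m : ℤ) := by
    rw [natCast_floor_eq_intCast_floor (mul_nonneg hq'.le (Int.fract_nonneg _)),
      natCast_floor_eq_intCast_floor hgn, h1, Int.floor_sub_intCast]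
    push_cast; ring
  have h3 : (⌊g n⌋₊ : ℝ) * r =
      ((⌊(r.den : ℝ) * Int.fract (g n / r.den)⌋₊ : ℕ) : ℝ) * r + ((m * r.num : ℤ) : ℝ) := by
    rw [h2]; push_cast; rw [← hqr]; ring
  beta_reduce
  rw [h3, unitExp_add, unitExp_intCast, mul_one]

/-- The exponential sums of `⌊g n⌋` have vanishing means at all nontrivial frequencies. -/
theorem tendsto_cesaroMean_fourier_floor {g : ℕ → ℝ} (hg : ∀ n : ℕ, 1 ≤ n → 1 ≤ g n)
    (hirr : ∀ lam : ℝ, Irrational lam → IsUniformlyDistributedModOne (fun n => lam * g n))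
    (hrat : ∀ m : ℕ, 2 ≤ m → IsUniformlyDistributedModOne (fun n => g n / (m : ℝ)))
    {θ : UnitAddCircle} (hθ : θ ≠ 0) :
    Tendsto (cesaroMean fun n => fourier (⌊g n⌋₊ : ℤ) θ) atTop (𝓝 0) := by
  induction θ using QuotientAddGroup.induction_on with
  | H t =>
    have h : ∀ n, fourier (⌊g n⌋₊ : ℤ) (t : UnitAddCircle) = unitExp (⌊g n⌋₊ * t) := fun n => by
      rw [fourier_coe_eq_unitExp, Int.cast_natCast]
    refine Tendsto.congr (f₁ := cesaroMean fun n => unitExp (⌊g n⌋₊ * t)) (fun N => ?_) ?_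
    · congr 1; ext n; exact (h n).symm
    by_cases ht : Irrational t
    · exact tendsto_cesaroMean_floor_of_irrational hg hirr (by simpa using hrat 2 le_rfl) ht
    · obtain ⟨r, rfl⟩ := not_not.1 ht
      refine tendsto_cesaroMean_floor_of_rat hg hrat ?_
      rintro ⟨n, hn⟩
      exact hθ ((AddCircle.coe_eq_zero_iff 1).2 ⟨n, by simp [hn]⟩)

theorem integral_fourier_haarAddCircle (n : ℤ) :
    ∫ θ : UnitAddCircle, fourier n θ ∂AddCircle.haarAddCircle = if n = 0 then 1 else 0 := by
  split_ifs with h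
  · simp [h]
  · exact integral_eq_zero_of_add_right_eq_neg (μ := AddCircle.haarAddCircle)
      (fourier_add_half_inv_index h one_pos)

/-! ### Spectral measure of an isometry -/

section Spectral

variable {H : Type*} [NormedAddCommGroup H] [InnerProductSpace ℂ H]

theorem inner_iterate_add_isometry (U : H →ₗᵢ[ℂ] H) (x : H) (n k : ℕ) :
    inner ℂ (U^[n] x) (U^[n + k] x) = inner ℂ x (U^[k] x) := by
  induction n with
  | zero => simp
  | succ n ih =>
    rw [Nat.succ_add, Function.iterate_succ_apply', Function.iterate_succ_apply',
      U.inner_map_map, ih]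

theorem sq_norm_sum_eq (y : ℕ → H) (s : Finset ℕ) :
    ((‖∑ n ∈ s, y n‖ ^ 2 : ℝ) : ℂ) = ∑ n ∈ s, ∑ m ∈ s, inner ℂ (y n) (y m) := by
  rw [Complex.ofReal_pow, ← Complex.coe_algebraMap, ← inner_self_eq_norm_sq_to_K (𝕜 := ℂ), sum_inner]
  simp_rw [inner_sum]

/-- The Fejér densities of the orbit of `x` under an isometry. -/
noncomputable def fejerDensity (U : H →ₗᵢ[ℂ] H) (x : H) (N : ℕ) (θ : UnitAddCircle) : ℝ :=
  ‖∑ n ∈ Finset.range N, fourier (-n : ℤ) θ • U^[n] x‖ ^ 2 / N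

theorem continuous_fejerDensity (U : H →ₗᵢ[ℂ] H) (x : H) (N : ℕ) :
    Continuous (fejerDensity U x N) := by
  unfold fejerDensity; fun_prop

theorem fejerDensity_nonneg (U : H →ₗᵢ[ℂ] H) (x : H) (N : ℕ) (θ : UnitAddCircle) :
    0 ≤ fejerDensity U x N θ := by
  unfold fejerDensity; positivity

/-- Expanding the square, orthogonality of characters keeps only the pairs `m = n + k`, of which
there are `N - k` (truncated at zero), all with the same inner product. -/
theorem integral_fourier_mul_fejerDensity (U : H →ₗᵢ[ℂ] H) (x : H) (N k : ℕ) :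
    ∫ θ : UnitAddCircle, (fejerDensity U x N θ : ℂ) * fourier (k : ℤ) θ ∂AddCircle.haarAddCircle =
      ((N - k : ℕ) : ℂ) / N * inner ℂ x (U^[k] x) := by
  have h1 : ∀ θ : UnitAddCircle, (fejerDensity U x N θ : ℂ) * fourier (k : ℤ) θ =
      ∑ n ∈ Finset.range N, ∑ m ∈ Finset.range N,
        fourier (n - m + k : ℤ) θ * (inner ℂ (U^[n] x) (U^[m] x) / N) := by
    intro θ
    rw [fejerDensity, Complex.ofReal_div, sq_norm_sum_eq, Complex.ofReal_natCast, Finset.sum_div,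
      Finset.sum_mul]
    refine Finset.sum_congr rfl fun n _ => ?_
    rw [Finset.sum_div, Finset.sum_mul]
    refine Finset.sum_congr rfl fun m _ => ?_
    rw [inner_smul_left, inner_smul_right, ← fourier_neg, neg_neg, sub_eq_add_neg, fourier_add,
      fourier_add]
    ring
  have hint : ∀ (j : ℤ) (c : ℂ), Integrable (fun θ : UnitAddCircle => fourier j θ * c)
      AddCircle.haarAddCircle := fun j c =>
    (((fourier j).continuous.integrable_of_hasCompactSupport
      (HasCompactSupport.of_compactSpace _))).mul_const c
  simp_rw [h1]
  rw [integral_finsetSum _ fun n _ => integrable_finsetSum _ fun m _ => hint _ _]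
  simp_rw [integral_finsetSum _ fun m _ => hint _ _, integral_mul_const,
    integral_fourier_haarAddCircle]
  have h2 : ∀ n ∈ Finset.range N, (∑ m ∈ Finset.range N,
      (if (n - m + k : ℤ) = 0 then (1 : ℂ) else 0) * (inner ℂ (U^[n] x) (U^[m] x) / N)) =
      if n < N - k then inner ℂ x (U^[k] x) / N else 0 := by
    intro n hn
    have h3 : ∀ m : ℕ, ((n - m + k : ℤ) = 0) ↔ n + k = m := fun m => by omega
    simp_rw [h3, ite_mul, one_mul, zero_mul, Finset.sum_ite_eq, Finset.mem_range,
      inner_iterate_add_isometry]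
    exact if_congr (by omega) rfl rfl
  rw [Finset.sum_congr rfl h2, ← Finset.sum_filter, Finset.sum_const]
  have h4 : {n ∈ Finset.range N | n < N - k} = Finset.range (N - k) := by
    ext n; simp; omega
  rw [h4, Finset.card_range, nsmul_eq_mul]
  ring

/-- **Herglotz's theorem** for the orbit of a unit vector under an isometry: the correlation
sequence is given by the Fourier coefficients of a probability measure on the circle. -/
theorem exists_spectralMeasure (U : H →ₗᵢ[ℂ] H) {x : H} (hx : ‖x‖ = 1) :
    ∃ σ : ProbabilityMeasure UnitAddCircle, ∀ k : ℕ,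
      ∫ θ, fourier (k : ℤ) θ ∂(σ : Measure UnitAddCircle) = inner ℂ x (U^[k] x) := by
  -- The shift to `N + 1` avoids the zero density at `N = 0`. Total mass one is the case `k = 0` of
  -- the moment formula.
  let ν : ℕ → Measure UnitAddCircle := fun N =>
    AddCircle.haarAddCircle.withDensity fun θ => ((fejerDensity U x (N + 1) θ).toNNReal : ENNReal)
  have hmeas : ∀ N, Measurable fun θ => (fejerDensity U x (N + 1) θ).toNNReal := fun N =>
    (continuous_fejerDensity U x _).measurable.real_toNNReal
  have hν : ∀ N k : ℕ, ∫ θ, fourier (k : ℤ) θ ∂(ν N) =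
      ((N + 1 - k : ℕ) : ℂ) / (N + 1 : ℕ) * inner ℂ x (U^[k] x) := by
    intro N k
    rw [integral_withDensity_eq_integral_smul (hmeas N), ← integral_fourier_mul_fejerDensity]
    refine integral_congr_ae (Eventually.of_forall fun θ => ?_)
    simp only [NNReal.smul_def, Real.coe_toNNReal _ (fejerDensity_nonneg U x (N + 1) θ),
      Complex.real_smul]
  have hprob : ∀ N, IsProbabilityMeasure (ν N) := by
    intro N
    have hfin : IsFiniteMeasure (ν N) := by
      refine isFiniteMeasure_withDensity_ofReal ?_
      exact ((continuous_fejerDensity U x _).integrable_of_hasCompactSupport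
        (HasCompactSupport.of_compactSpace _)).hasFiniteIntegral
    have := hν N 0
    have hN : ((N + 1 : ℕ) : ℂ) ≠ 0 := by exact_mod_cast N.succ_ne_zero
    simp only [Nat.cast_zero, fourier_zero, integral_const, Function.iterate_zero, id,
      Nat.sub_zero, div_self hN, one_mul, inner_self_eq_norm_sq_to_K, hx] at this
    rw [isProbabilityMeasure_iff_real]
    simpa using this
  let P : ℕ → ProbabilityMeasure UnitAddCircle := fun N => ⟨ν N, hprob N⟩
  -- Probability measures on the compact circle form a weakly compact space; a limit along a free
  -- ultrafilter replaces the choice of a subsequence.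
  obtain ⟨σ, -, hσ⟩ := isCompact_univ.ultrafilter_le_nhds ((hyperfilter ℕ).map P) (by simp)
  refine ⟨σ, fun k => ?_⟩
  have hlim : Tendsto P (hyperfilter ℕ) (𝓝 σ) := hσ
  rw [ProbabilityMeasure.tendsto_iff_forall_integral_rclike_tendsto ℂ] at hlim
  have h1 := hlim (BoundedContinuousFunction.mkOfCompact (fourier (k : ℤ)))
  simp only [BoundedContinuousFunction.mkOfCompact_apply] at h1
  refine tendsto_nhds_unique h1 (Tendsto.mono_left ?_ Nat.hyperfilter_le_atTop)
  have h2 : ∀ N, ∫ θ, fourier (k : ℤ) θ ∂(P N : Measure UnitAddCircle) =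
    ((N + 1 - k : ℕ) : ℂ) / (N + 1 : ℕ) * inner ℂ x (U^[k] x) := fun N => hν N k
  simp_rw [h2]
  have h3 : Tendsto (fun N : ℕ => ((N - k : ℕ) : ℂ) / (N : ℕ)) atTop (𝓝 1) := by
    have h4 : Tendsto (fun N : ℕ => 1 - (k : ℂ) / N) atTop (𝓝 (1 - 0)) :=
      tendsto_const_nhds.sub (tendsto_const_div_atTop_nhds_zero_nat (k : ℂ))
    rw [sub_zero] at h4
    refine h4.congr' ?_
    filter_upwards [eventually_ge_atTop (k + 1)] with N hN
    have : (N : ℂ) ≠ 0 := by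
      have : N ≠ 0 := by omega
      exact_mod_cast this
    rw [Nat.cast_sub (by omega)]
    field_simp
  simpa using ((tendsto_add_atTop_iff_nat 1).2 h3).mul_const (inner ℂ x (U^[k] x))

theorem inner_iterate_eq_integral {U : H →ₗᵢ[ℂ] H} {x : H} {σ : Measure UnitAddCircle}
    (hσ : ∀ k : ℕ, ∫ θ, fourier (k : ℤ) θ ∂σ = inner ℂ x (U^[k] x)) (n m : ℕ) :
    inner ℂ (U^[n] x) (U^[m] x) = ∫ θ, fourier (m - n : ℤ) θ ∂σ := by
  rcases le_total n m with h | h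
  · obtain ⟨k, rfl⟩ := Nat.exists_eq_add_of_le h
    rw [inner_iterate_add_isometry, ← hσ]
    congr with θ; congr 2; omega
  · obtain ⟨k, rfl⟩ := Nat.exists_eq_add_of_le h
    rw [← inner_conj_symm, inner_iterate_add_isometry, ← hσ, ← integral_conj]
    congr with θ
    rw [← fourier_neg]; congr 2; omega

/-- The isometry between the cyclic space of `x` and `L²` of its spectral measure. -/
theorem sq_norm_sum_iterate_eq_integral {U : H →ₗᵢ[ℂ] H} {x : H} {σ : Measure UnitAddCircle}
    [IsFiniteMeasure σ]
    (hσ : ∀ k : ℕ, ∫ θ, fourier (k : ℤ) θ ∂σ = inner ℂ x (U^[k] x)) (a : ℕ → ℕ) (s : Finset ℕ) :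
    ‖∑ n ∈ s, U^[a n] x‖ ^ 2 = ∫ θ, ‖∑ n ∈ s, fourier (a n : ℤ) θ‖ ^ 2 ∂σ := by
  have hint : ∀ j : ℤ, Integrable (fun θ : UnitAddCircle => fourier j θ) σ := fun j =>
    (fourier j).continuous.integrable_of_hasCompactSupport (HasCompactSupport.of_compactSpace _)
  apply Complex.ofReal_injective
  rw [sq_norm_sum_eq, ← integral_complex_ofReal]
  simp_rw [sq_norm_sum_eq, RCLike.inner_apply, ← fourier_neg, ← fourier_add, ← sub_eq_add_neg]
  rw [integral_finsetSum _ fun n _ => integrable_finsetSum _ fun m _ => hint _]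
  simp_rw [integral_finsetSum _ fun m _ => hint _, inner_iterate_eq_integral hσ]

theorem sq_norm_mean_iterate_eq_integral {U : H →ₗᵢ[ℂ] H} {x : H} {σ : Measure UnitAddCircle}
    [IsFiniteMeasure σ]
    (hσ : ∀ k : ℕ, ∫ θ, fourier (k : ℤ) θ ∂σ = inner ℂ x (U^[k] x)) (a : ℕ → ℕ) (s : Finset ℕ)
    (c : ℂ) :
    ‖c • ∑ n ∈ s, U^[a n] x‖ ^ 2 = ∫ θ, ‖c * ∑ n ∈ s, fourier (a n : ℤ) θ‖ ^ 2 ∂σ := by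
  simp_rw [norm_smul, norm_mul, mul_pow, integral_const_mul,
    sq_norm_sum_iterate_eq_integral hσ]

theorem norm_mean_fourier_le (a : ℕ → ℤ) (s : Finset ℕ) (θ : UnitAddCircle) :
    ‖(1 / (s.card : ℂ)) * ∑ n ∈ s, fourier (a n) θ‖ ≤ 1 := by
  rw [norm_mul, norm_div, norm_one, Complex.norm_natCast, div_mul_eq_mul_div, one_mul]
  apply div_le_of_le_mul₀ (Nat.cast_nonneg _) zero_le_one
  calc _ ≤ ∑ n ∈ s, ‖fourier (a n) θ‖ := norm_sum_le _ _
    _ = 1 * s.card := by simp only [fourier_apply, Circle.norm_coe]; simp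

/-- If the ergodic means of `x` vanish, its spectral measure has no atom at `0`. -/
theorem spectralMeasure_singleton_zero {U : H →ₗᵢ[ℂ] H} {x : H} {σ : Measure UnitAddCircle}
    [IsFiniteMeasure σ]
    (hσ : ∀ k : ℕ, ∫ θ, fourier (k : ℤ) θ ∂σ = inner ℂ x (U^[k] x))
    (h : Tendsto (fun N => birkhoffAverage ℂ U _root_.id N x) atTop (𝓝 0)) : σ {0} = 0 := by
  -- The mean of the characters equals 1 at `θ = 0`, so its squared modulus dominates the indicator
  -- of `{0}`.
  have h1 : ∀ N : ℕ, 1 ≤ N → σ.real {0} ≤ ‖birkhoffAverage ℂ U _root_.id N x‖ ^ 2 := by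
    intro N hN
    have hN' : (N : ℂ) ≠ 0 := by
      have : N ≠ 0 := by omega
      exact_mod_cast this
    have h2 := sq_norm_mean_iterate_eq_integral hσ (fun n => n) (Finset.range N) ((N : ℂ)⁻¹)
    rw [birkhoffAverage, birkhoffSum]
    simp only [id] at h2 ⊢
    rw [h2, ← integral_indicator_one (measurableSet_singleton _)]
    refine integral_mono ?_ ?_ fun θ => ?_
    · exact (integrable_indicator_iff (measurableSet_singleton _)).2 (integrable_const _).integrableOn
    · exact Continuous.integrable_of_hasCompactSupport (by fun_prop)
        (HasCompactSupport.of_compactSpace _)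
    · by_cases hθ : θ = 0
      · subst hθ
        simp [inv_mul_cancel₀ hN']
      · simp only [Set.indicator_of_notMem (Set.mem_singleton_iff.not.2 hθ)]
        positivity
  have h2 : σ.real {0} ≤ 0 := by
    refine ge_of_tendsto (by simpa using (h.norm.pow 2)) ?_
    filter_upwards [eventually_ge_atTop 1] with N hN using h1 N hN
  exact (measureReal_eq_zero_iff).1 (le_antisymm h2 measureReal_nonneg)

/-- If the exponential means along `a` vanish at all nontrivial frequencies, then the means along
`a` of an isometry vanish at each vector whose ergodic means vanish. -/
theorem tendsto_mean_iterate_zero (U : H →ₗᵢ[ℂ] H) (a : ℕ → ℕ)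
    (ha : ∀ θ : UnitAddCircle, θ ≠ 0 →
      Tendsto (cesaroMean fun n => fourier (a n : ℤ) θ) atTop (𝓝 0)) (x : H)
    (hx : Tendsto (fun N => birkhoffAverage ℂ U _root_.id N x) atTop (𝓝 0)) :
    Tendsto (fun N : ℕ => (1 / (N : ℂ)) • ∑ n ∈ Finset.Icc 1 N, U^[a n] x) atTop (𝓝 0) := by
  -- Both means are homogeneous in `x`; normalising makes the spectral measure a probability
  -- measure.
  wlog hx1 : ‖x‖ = 1 generalizing x
  · have hU : ∀ (n : ℕ) (c : ℂ) (y : H), U^[n] (c • y) = c • U^[n] y := by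
      intro n c y
      induction n with
      | zero => rfl
      | succ n ih =>
        rw [Function.iterate_succ_apply', Function.iterate_succ_apply', ih, U.map_smul]
    by_cases hx0 : x = 0
    · subst hx0
      have hz : ∀ n, U^[n] (0 : H) = 0 := fun n => by simpa only [zero_smul] using hU n 0 0
      simp [hz]
    · have hn : (‖x‖ : ℂ) ≠ 0 := by exact_mod_cast norm_ne_zero_iff.2 hx0
      have := this ((‖x‖ : ℂ)⁻¹ • x) ?_ ?_
      · have h2 := this.const_smul (‖x‖ : ℂ)
        rw [smul_zero] at h2
        refine h2.congr fun N => ?_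
        simp_rw [hU, ← Finset.smul_sum]
        rw [smul_comm, smul_smul (‖x‖ : ℂ), mul_inv_cancel₀ hn, one_smul]
      · have h2 := hx.const_smul (‖x‖ : ℂ)⁻¹
        rw [smul_zero] at h2
        refine h2.congr fun N => ?_
        simp only [birkhoffAverage, birkhoffSum, id, hU, ← Finset.smul_sum]
        rw [smul_comm]
      · rw [norm_smul, norm_inv, Complex.norm_real, norm_norm,
          inv_mul_cancel₀ (norm_ne_zero_iff.2 hx0)]
  obtain ⟨σ, hσ⟩ := exists_spectralMeasure U hx1
  have h0 := spectralMeasure_singleton_zero hσ hx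
  have hae : ∀ᵐ θ ∂(σ : Measure UnitAddCircle), θ ≠ 0 := by
    rw [ae_iff]; simpa using h0
  have hlim : Tendsto (fun N : ℕ => ∫ θ, ‖cesaroMean (fun n => fourier (a n : ℤ) θ) N‖ ^ 2
      ∂(σ : Measure UnitAddCircle)) atTop (𝓝 (∫ _, (0 : ℝ) ∂(σ : Measure UnitAddCircle))) := by
    refine tendsto_integral_of_dominated_convergence (fun _ => 1) (fun N => ?_)
      (integrable_const _) (fun N => Eventually.of_forall fun θ => ?_) ?_
    · refine Continuous.aestronglyMeasurable ?_
      unfold cesaroMean; fun_prop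
    · have := norm_mean_fourier_le (fun n => a n) (Finset.Icc 1 N) θ
      rw [Nat.card_Icc, Nat.add_sub_cancel] at this
      rw [Real.norm_of_nonneg (by positivity)]
      exact pow_le_one₀ (norm_nonneg _) this
    · filter_upwards [hae] with θ hθ
      simpa using (ha θ hθ).norm.pow 2
  rw [integral_zero] at hlim
  have hsqrt := hlim.sqrt
  rw [Real.sqrt_zero] at hsqrt
  rw [tendsto_zero_iff_norm_tendsto_zero]
  refine hsqrt.congr fun N => ?_
  simp only [cesaroMean]
  rw [← sq_norm_mean_iterate_eq_integral hσ, Real.sqrt_sq (norm_nonneg _)]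

end Spectral

/-! ### Koopman operator and conclusion -/

section Koopman

variable {X : Type u} [MeasurableSpace X] {μ : Measure X} {T : X → X}

/-- The Koopman operator of a measure-preserving map on `L²`. -/
noncomputable def koopman (hT : MeasurePreserving T μ μ) : Lp ℂ 2 μ →ₗᵢ[ℂ] Lp ℂ 2 μ :=
  Lp.compMeasurePreservingₗᵢ ℂ T hT

theorem koopman_iterate_toLp (hT : MeasurePreserving T μ μ) {h : X → ℂ} (hh : MemLp h 2 μ)
    (n : ℕ) : (koopman hT)^[n] (hh.toLp h) =ᵐ[μ] fun x => h (T^[n] x) := by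
  have h1 : (koopman hT : Lp ℂ 2 μ → Lp ℂ 2 μ) = Lp.compMeasurePreserving T hT := rfl
  rw [h1, Lp.compMeasurePreserving_iterate, Lp.toLp_compMeasurePreserving]
  exact MemLp.coeFn_toLp _

/-- By von Neumann's theorem the limit is the projection onto the fixed vectors. By ergodicity these
are a.e. constant, hence orthogonal to a function of integral zero. -/
theorem Ergodic.tendsto_birkhoffAverage_koopman_zero [IsFiniteMeasure μ] (hT : Ergodic T μ) {h : X → ℂ}
    (hh : MemLp h 2 μ) (h0 : ∫ x, h x ∂μ = 0) :
    Tendsto (fun N => birkhoffAverage ℂ (koopman hT.toMeasurePreserving) _root_.id N (hh.toLp h))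
      atTop (𝓝 0) := by
  let U := (koopman hT.toMeasurePreserving).toContinuousLinearMap
  have hU : ‖U‖ ≤ 1 := (koopman hT.toMeasurePreserving).norm_toContinuousLinearMap_le
  have h1 := U.tendsto_birkhoffAverage_orthogonalProjection hU (hh.toLp h)
  have h2 : hh.toLp h ∈ (U.eqLocus (1 : Lp ℂ 2 μ →L[ℂ] Lp ℂ 2 μ))ᗮ := by
    rw [Submodule.mem_orthogonal]
    intro y hy
    have hy1 : Lp.compMeasurePreserving T hT.toMeasurePreserving y = y := hy
    have hy2 : y ∘ T =ᵐ[μ] y := by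
      have := Lp.coeFn_compMeasurePreserving y hT.toMeasurePreserving
      rw [hy1] at this
      exact this.symm
    obtain ⟨c, hc⟩ := hT.ae_eq_const_of_ae_eq_comp_ae (Lp.aestronglyMeasurable y) hy2
    rw [L2.inner_def]
    have h3 : (fun x => inner ℂ (y x) (hh.toLp h x)) =ᵐ[μ] fun x => h x * (starRingEnd ℂ) c := by
      filter_upwards [hc, hh.coeFn_toLp] with x hx hx'
      rw [hx, hx', RCLike.inner_apply, Function.const_apply]
    rw [integral_congr_ae h3, integral_mul_const, h0, zero_mul]
  rw [Submodule.orthogonalProjectionOnto_eq_zero_iff.2 h2] at h1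
  exact h1

end Koopman

theorem theorem3p4 (g : ℕ → ℝ) (hg : ∀ n : ℕ, 1 ≤ n → 1 ≤ g n)
    (hirr : ∀ lam : ℝ, Irrational lam → IsUniformlyDistributedModOne (fun n => lam * g n))
    (hrat : ∀ m : ℕ, 2 ≤ m → IsUniformlyDistributedModOne (fun n => g n / (m : ℝ))) :
    IsNormErgodic.{u} (fun n => ⌊g n⌋₊) := by
  intro X _ μ _ T _ hT f hf
  have hh : MemLp (fun x => f x - ∫ y, f y ∂μ) 2 μ := hf.sub (memLp_const _)
  have h0 : ∫ x, (f x - ∫ y, f y ∂μ) ∂μ = 0 := by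
    rw [integral_sub (hf.integrable (by norm_num)) (integrable_const _)]
    simp
  have key := tendsto_mean_iterate_zero (koopman hT.toMeasurePreserving) (fun n => ⌊g n⌋₊)
    (fun θ hθ => tendsto_cesaroMean_fourier_floor hg hirr hrat hθ) _
    (hT.tendsto_birkhoffAverage_koopman_zero hh h0)
  have key' := key.enorm
  rw [enorm_zero] at key'
  refine key'.congr' ?_
  -- Pulling `∫ f` out of the average needs `N ≠ 0`: the empty average is 0 by convention.
  filter_upwards [eventually_ge_atTop 1] with N hN
  have hN' : (N : ℂ) ≠ 0 := by
    have : N ≠ 0 := by omega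
    exact_mod_cast this
  rw [Lp.enorm_def]
  refine eLpNorm_congr_ae ?_
  have hall : ∀ᵐ x ∂μ, ∀ n : ℕ, ((koopman hT.toMeasurePreserving)^[⌊g n⌋₊] (hh.toLp _)) x =
      f (T^[⌊g n⌋₊] x) - ∫ y, f y ∂μ :=
    ae_all_iff.2 fun n => koopman_iterate_toLp hT.toMeasurePreserving hh _
  filter_upwards [hall, Lp.coeFn_smul (1 / (N : ℂ)) (∑ n ∈ Finset.Icc 1 N,
    (koopman hT.toMeasurePreserving)^[⌊g n⌋₊] (hh.toLp _)),
    Lp.coeFn_finsetSum (Finset.Icc 1 N)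
      (fun n => (koopman hT.toMeasurePreserving)^[⌊g n⌋₊] (hh.toLp _))] with x h1 h2 h3
  rw [h2, Pi.smul_apply, h3, Finset.sum_apply, smul_eq_mul]
  simp_rw [h1]
  rw [Finset.sum_sub_distrib, Finset.sum_const, Nat.card_Icc, Nat.add_sub_cancel, nsmul_eq_mul,
    mul_sub]
  field_simp
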